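/- Let $R$ be a commutative ring with unit and let $\mathcal R$ be the functor of rings $\mathcal R(R')=R'$ on the category of commutative $R$-algebras. An $\mathcal R$-module is a covariant functor $\mathbb M$ from commutative $R$-algebras to abelian groups together with an $R'$-module structure on $\mathbb M(R')$ for every commutative $R$-algebra $R'$, functorial in $R'$ (that is, a morphism of functors $\mathcal R\times\mathbb M\to\mathbb M$ satisfying the module axioms). For an $R$-module $M$, let $\mathcal M$ denote the $\mathcal R$-module $\mathcal M(R')=M\otimes_R R'$. A module $R$-scheme is a commutative group scheme $X$ over $\operatorname{Spec} R$ together with a morphism of $R$-schemes $\mathbb A^1_R\times_R X\to X$ satisfying the module axioms; its functor of points $X^{\cdot}(R')=\operatorname{Hom}_{R\text{-sch}}(\operatorname{Spec} R',X)$ is then an $\mathcal R$-module. Let $M$ be an $R$-module. Then $\mathcal M$ is isomorphic, as an $\mathcal R$-module, to the functor of points $X^{\cdot}$ of some module $R$-scheme $X$ whose underlying scheme is quasi-compact and quasi-separated if and only if $M$ is a finitely generated projective $R$-module. -/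

import Mathlib

open CategoryTheory AlgebraicGeometry MonoidalCategory CartesianMonoidalCategory Opposite
open scoped TensorProduct AddMonObj

universe u

/-- An `𝓡`-module over a commutative ring `R`: a covariant functor `𝕄` from commutative
`R`-algebras to abelian groups, with an `A`-module structure on `𝕄(A)` for every `R`-algebra `A`,
such that the action map `𝓡 × 𝕄 → 𝕄` is a morphism of functors, where `𝓡(A) = A`. -/
structure RModuleFunctor (R : Type u) [CommRing R] where
  obj : CommAlgCat.{u} R → Type u
  [addCommGroup : ∀ A, AddCommGroup (obj A)]
  [module : ∀ A : CommAlgCat.{u} R, Module A (obj A)]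
  map : ∀ {A B : CommAlgCat.{u} R}, (A ⟶ B) → (obj A →+ obj B)
  map_id : ∀ (A : CommAlgCat.{u} R) (x : obj A), map (𝟙 A) x = x
  map_comp : ∀ {A B C : CommAlgCat.{u} R} (f : A ⟶ B) (g : B ⟶ C) (x : obj A),
    map (f ≫ g) x = map g (map f x)
  map_smul : ∀ {A B : CommAlgCat.{u} R} (f : A ⟶ B) (a : A) (x : obj A),
    map f (a • x) = f.hom a • map f x

attribute [instance] RModuleFunctor.addCommGroup RModuleFunctor.module

/-- An isomorphism of `𝓡`-modules: an isomorphism of functors whose component at every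
commutative `R`-algebra `A` is `A`-linear. -/
structure RModuleFunctor.Iso {R : Type u} [CommRing R] (P Q : RModuleFunctor R) where
  app : ∀ A : CommAlgCat.{u} R, P.obj A ≃ₗ[A] Q.obj A
  naturality : ∀ {A B : CommAlgCat.{u} R} (f : A ⟶ B) (x : P.obj A),
    app B (P.map f x) = Q.map f (app A x)

/-- The quasi-coherent `𝓡`-module `𝓜` associated with an `R`-module `M`:
the functor `A ↦ A ⊗[R] M`. -/
noncomputable def quasiCoherentFunctor (R : Type u) [CommRing R]
    (M : Type u) [AddCommGroup M] [Module R M] : RModuleFunctor R where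
  obj A := A ⊗[R] M
  map f := (f.hom.toLinearMap.rTensor M).toAddMonoidHom
  map_id A x := by
    change (LinearMap.rTensor M LinearMap.id) x = x
    simp
  map_comp f g x := by
    change (LinearMap.rTensor M (g.hom.toLinearMap ∘ₗ f.hom.toLinearMap)) x = _
    rw [LinearMap.rTensor_comp]
    rfl
  map_smul f a x := by
    change f.hom.toLinearMap.rTensor M (a • x) = f.hom a • f.hom.toLinearMap.rTensor M x
    induction x with
    | zero => simp
    | add x y hx hy => simp only [smul_add, map_add, hx, hy]
    | tmul b m => simp [TensorProduct.smul_tmul']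

/-- The affine line `𝔸¹_R` as a scheme over `Spec R`. -/
noncomputable def affineLine (R : Type u) [CommRing R] : Over (Spec (.of R)) :=
  Over.mk (𝔸(PUnit.{u + 1}; Spec (.of R)) ↘ Spec (.of R))

/-- The `T`-point of `𝔸¹_R` whose coordinate is the global function `a` on the `R`-scheme `T`.
The ring scheme structure of `𝔸¹_R` is the ring structure of `Γ(T, ⊤)` on `T`-points
(see `affineLineEquiv`). -/
noncomputable def affineLinePoint {R : Type u} [CommRing R] {T : Over (Spec (.of R))}
    (a : Γ(T.left, ⊤)) : T ⟶ affineLine R :=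
  Over.homMk (AffineSpace.homOfVector T.hom fun _ ↦ a) (AffineSpace.homOfVector_over _ _)

/-- The `T`-points of `𝔸¹_R` are the global functions on `T`. -/
noncomputable def affineLineEquiv {R : Type u} [CommRing R] (T : Over (Spec (.of R))) :
    Γ(T.left, ⊤) ≃ (T ⟶ affineLine R) where
  toFun := affineLinePoint
  invFun f := f.left.appTop (AffineSpace.coord (Spec (.of R)) PUnit.unit)
  left_inv a := AffineSpace.homOfVector_appTop_coord _ _ _
  right_inv f := by
    apply Over.OverMorphism.ext
    apply AffineSpace.hom_ext
    · exact (AffineSpace.homOfVector_over _ _).trans (Over.w f).symm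
    · intro i
      exact AffineSpace.homOfVector_appTop_coord _ _ _

theorem comp_affineLinePoint {R : Type u} [CommRing R] {S T : Over (Spec (.of R))}
    (f : S ⟶ T) (a : Γ(T.left, ⊤)) :
    f ≫ affineLinePoint a = affineLinePoint (f.left.appTop a) := by
  apply Over.OverMorphism.ext
  change f.left ≫ AffineSpace.homOfVector T.hom _ = AffineSpace.homOfVector S.hom _
  rw [AffineSpace.comp_homOfVector, Over.w f]
  rfl

/-- A module `R`-scheme: a commutative group scheme `X` over `Spec R` with a morphism of
`R`-schemes `𝔸¹_R × X → X` satisfying the module axioms. The axioms are identities between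
morphisms of `R`-schemes, written on `T`-points for an arbitrary `R`-scheme `T`. -/
structure ModuleScheme (R : Type u) [CommRing R] where
  X : Over (Spec (.of R))
  [addGrpObj : AddGrpObj X]
  [isCommAddMonObj : IsCommAddMonObj X]
  act : affineLine R ⊗ X ⟶ X
  act_add : ∀ {T : Over (Spec (.of R))} (a : Γ(T.left, ⊤)) (x y : T ⟶ X),
    lift (affineLinePoint a) (x + y) ≫ act =
      lift (affineLinePoint a) x ≫ act + lift (affineLinePoint a) y ≫ act
  add_act : ∀ {T : Over (Spec (.of R))} (a b : Γ(T.left, ⊤)) (x : T ⟶ X),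
    lift (affineLinePoint (a + b)) x ≫ act =
      lift (affineLinePoint a) x ≫ act + lift (affineLinePoint b) x ≫ act
  mul_act : ∀ {T : Over (Spec (.of R))} (a b : Γ(T.left, ⊤)) (x : T ⟶ X),
    lift (affineLinePoint (a * b)) x ≫ act =
      lift (affineLinePoint a) (lift (affineLinePoint b) x ≫ act) ≫ act
  one_act : ∀ {T : Over (Spec (.of R))} (x : T ⟶ X),
    lift (affineLinePoint (1 : Γ(T.left, ⊤))) x ≫ act = x

attribute [instance] ModuleScheme.addGrpObj ModuleScheme.isCommAddMonObj

/-- The spectrum of a commutative `R`-algebra, as an `R`-scheme. -/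
noncomputable abbrev specOver {R : Type u} [CommRing R] (A : CommAlgCat.{u} R) :
    Over (Spec (.of R)) :=
  Over.mk (Spec.map (CommRingCat.ofHom (algebraMap R A)))

/-- The morphism of `R`-schemes `Spec B ⟶ Spec A` induced by a morphism `A ⟶ B`. -/
noncomputable def specOverMap {R : Type u} [CommRing R] {A B : CommAlgCat.{u} R} (f : A ⟶ B) :
    specOver B ⟶ specOver A :=
  Over.homMk (Spec.map (CommRingCat.ofHom f.hom.toRingHom)) (by
    change Spec.map _ ≫ Spec.map _ = Spec.map _
    rw [← Spec.map_comp, ← CommRingCat.ofHom_comp]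
    congr 2
    exact f.hom.comp_algebraMap)

theorem specOverMap_id {R : Type u} [CommRing R] (A : CommAlgCat.{u} R) :
    specOverMap (𝟙 A) = 𝟙 (specOver A) := by
  apply Over.OverMorphism.ext
  exact Spec.map_id _

theorem specOverMap_comp {R : Type u} [CommRing R] {A B C : CommAlgCat.{u} R}
    (f : A ⟶ B) (g : B ⟶ C) :
    specOverMap (f ≫ g) = specOverMap g ≫ specOverMap f := by
  apply Over.OverMorphism.ext
  exact Spec.map_comp (CommRingCat.ofHom f.hom.toRingHom) (CommRingCat.ofHom g.hom.toRingHom)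

/-- The action of `a : A` on an `A`-valued point `x : Spec A ⟶ X` of a module scheme. -/
noncomputable def ModuleScheme.pointSMul {R : Type u} [CommRing R] (X : ModuleScheme R)
    {A : CommAlgCat.{u} R} (a : A) (x : specOver A ⟶ X.X) : specOver A ⟶ X.X :=
  lift (affineLinePoint (T := specOver A) ((Scheme.ΓSpecIso (.of A)).inv a)) x ≫ X.act

theorem ModuleScheme.comp_pointSMul {R : Type u} [CommRing R] (X : ModuleScheme R)
    {A B : CommAlgCat.{u} R} (f : A ⟶ B) (a : A) (x : specOver A ⟶ X.X) :
    specOverMap f ≫ X.pointSMul a x = X.pointSMul (f.hom a) (specOverMap f ≫ x) := by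
  have h := Scheme.ΓSpecIso_inv_naturality (CommRingCat.ofHom f.hom.toRingHom)
  have h' : (specOverMap f).left.appTop ((Scheme.ΓSpecIso (.of A)).inv a) =
      (Scheme.ΓSpecIso (.of B)).inv (f.hom a) := (congr($h a)).symm
  unfold ModuleScheme.pointSMul
  rw [← Category.assoc, comp_lift, comp_affineLinePoint]
  exact congr(lift (affineLinePoint $h') (specOverMap f ≫ x) ≫ X.act)

/-- The functor of points `A ↦ Hom_{R-sch}(Spec A, X)` of a module `R`-scheme `X`,
with its structure of `𝓡`-module. -/
noncomputable def ModuleScheme.functorOfPoints {R : Type u} [CommRing R] (X : ModuleScheme R) :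
    RModuleFunctor R where
  obj A := specOver A ⟶ X.X
  module A :=
    { smul := X.pointSMul
      one_smul := fun x ↦ by
        change X.pointSMul 1 x = x
        rw [ModuleScheme.pointSMul, map_one]
        exact X.one_act x
      mul_smul := fun a b x ↦ by
        change X.pointSMul (a * b) x = X.pointSMul a (X.pointSMul b x)
        rw [ModuleScheme.pointSMul, map_mul]
        exact X.mul_act _ _ x
      smul_add := fun a x y ↦ X.act_add _ x y
      add_smul := fun a b x ↦ by
        change X.pointSMul (a + b) x = X.pointSMul a x + X.pointSMul b x
        rw [ModuleScheme.pointSMul, map_add]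
        exact X.add_act _ _ x
      smul_zero := fun a ↦ by
        have h := X.act_add (T := specOver A) ((Scheme.ΓSpecIso (.of A)).inv a) 0 0
        rw [add_zero] at h
        exact left_eq_add.mp h
      zero_smul := fun x ↦ by
        have h := X.add_act (T := specOver A) 0 0 x
        rw [add_zero] at h
        change X.pointSMul 0 x = 0
        rw [ModuleScheme.pointSMul, map_zero]
        exact left_eq_add.mp h }
  map f :=
    { toFun := fun x ↦ specOverMap f ≫ x
      map_zero' := AddMonObj.comp_zero _
      map_add' := fun x y ↦ AddMonObj.comp_add _ x y }
  map_id A x := by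
    change specOverMap (𝟙 A) ≫ x = x
    rw [specOverMap_id, Category.id_comp]
  map_comp f g x := by
    change specOverMap (f ≫ g) ≫ x = specOverMap g ≫ specOverMap f ≫ x
    rw [specOverMap_comp, Category.assoc]
  map_smul f a x := X.comp_pointSMul f a x

/-- An `𝓡`-module is a quasi-compact and quasi-separated `𝓡`-module scheme if it is isomorphic, as
an `𝓡`-module, to the functor of points of a module `R`-scheme whose underlying scheme is
quasi-compact and quasi-separated. -/
def RModuleFunctor.IsQcqsModuleScheme {R : Type u} [CommRing R] (P : RModuleFunctor R) : Prop :=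
  ∃ X : ModuleScheme R, CompactSpace X.X.left ∧ QuasiSeparatedSpace X.X.left ∧
    Nonempty (P.Iso X.functorOfPoints)

/-! If `X` represents `A ↦ A ⊗ M`, then `M` is recovered from the infinitesimal neighbourhood of the
zero section. Let `Spec B ⊆ X` be an affine open containing the zero section over an `R`-algebra
`S`, and let `u ∈ B ⊗ M` correspond to the inclusion. A point over a nil-thickening of `S` that
reduces to zero has the same topological image as the zero section, so it factors uniquely through
`Spec B` (`isInfinitesimallyUniversal_of_isOpenImmersion`). For the thickening `S ⊕ S` with
square-zero second summand, such points are the elements `m ∈ S ⊗ M`, and each `b ∈ B` gets a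
derivative `∂_b` along them, linear in `m`. Writing `u = ∑ b_i ⊗ m_i` gives `m = ∑ ∂_{b_i}(m) ⊗
m_i`: a finite dual basis of `S ⊗ M`. Such `B` exist locally on `Spec R`, and finite projectivity
descends from localizations.

Conversely, for `M` finite projective, `A ⊗ M = Hom(M*, A)` is the set of `A`-points of the affine
scheme `Spec (Sym M*)`. -/

/-! ### Derivatives along square-zero deformations, and dual bases -/

section DualBasis

variable {R : Type u} [CommRing R] {M : Type u} [AddCommGroup M] [Module R M]

/-- A module with a finite dual basis is finite and projective. -/
theorem Module.finite_and_projective_of_dual_basis {S P ι : Type*} [CommRing S] [AddCommGroup P]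
    [Module S P] [Finite ι] (w : ι → P →ₗ[S] S) (e : ι → P)
    (h : ∀ m, ∑ᶠ i, w i m • e i = m) : Module.Finite S P ∧ Module.Projective S P := by
  have := Fintype.ofFinite ι
  have hc : Fintype.linearCombination S e ∘ₗ LinearMap.pi w = LinearMap.id := by
    ext m
    simpa [Fintype.linearCombination_apply, finsum_eq_sum_of_fintype] using h m
  exact ⟨.of_surjective (Fintype.linearCombination S e) fun m ↦
    ⟨LinearMap.pi w m, congr($hc m)⟩, .of_split _ _ hc⟩

/-- `u ∈ B ⊗ M` is universal among the infinitesimal deformations of `0 ∈ S ⊗ M`: it induces, by a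
unique algebra homomorphism, every element of `A ⊗ M` reducing to zero along a nil-thickening
`A → S`. -/
def IsInfinitesimallyUniversal (S : Type u) [CommRing S] [Algebra R S] {B : Type u} [CommRing B]
    [Algebra R B] (u : B ⊗[R] M) : Prop :=
  ∀ (A : Type u) [CommRing A] [Algebra R A] (π : A →ₐ[R] S), Function.Surjective π →
    (∀ a, π a = 0 → IsNilpotent a) → ∀ y : A ⊗[R] M, π.toLinearMap.rTensor M y = 0 →
      ∃! g : B →ₐ[R] A, g.toLinearMap.rTensor M u = y

namespace IsInfinitesimallyUniversal

variable {S : Type u} [CommRing S] [Algebra R S] {B : Type u} [CommRing B] [Algebra R B]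
  {u : B ⊗[R] M} (hu : IsInfinitesimallyUniversal S u)

section

variable (N : Type u) [AddCommGroup N] [Module S N] [Module Sᵐᵒᵖ N] [IsCentralScalar S N]
  [Module R N] [IsScalarTower R S N]

/-- The `R`-linear inclusion of the square-zero ideal `N` of `S ⊕ N`. -/
abbrev inrLinear : N →ₗ[R] TrivSqZeroExt S N := (TrivSqZeroExt.inrHom S N).restrictScalars R

/-- The `R`-linear projection of `S ⊕ N` on the square-zero ideal `N`. -/
abbrev sndLinear : TrivSqZeroExt S N →ₗ[R] N := (TrivSqZeroExt.sndHom S N).restrictScalars R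

-- The kernel `N` of `S ⊕ N → S` squares to zero, and elements of `N ⊗ M` die in `S ⊗ M`, so
-- universality applies.
include hu in
theorem existsUnique_hom (n : N ⊗[R] M) : ∃! g : B →ₐ[R] TrivSqZeroExt S N,
    g.toLinearMap.rTensor M u = (inrLinear N).rTensor M n := by
  -- The `R`-algebra structure on `TrivSqZeroExt S N` also needs compatibility with the right
  -- action.
  have hR : IsScalarTower R Sᵐᵒᵖ N := ⟨fun r s n ↦ by
    induction s using MulOpposite.rec' with | _ s
    rw [← MulOpposite.op_smul, op_smul_eq_smul, op_smul_eq_smul, smul_assoc]⟩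
  refine hu (TrivSqZeroExt S N) (TrivSqZeroExt.fstHom R S N) (fun s ↦ ⟨.inl s, rfl⟩) ?_ _ ?_
  · intro a ha
    refine ⟨2, ?_⟩
    replace ha : a.fst = 0 := ha
    ext <;> simp [pow_two, ha]
  · rw [← LinearMap.comp_apply, ← LinearMap.rTensor_comp]
    have : (TrivSqZeroExt.fstHom R S N).toLinearMap ∘ₗ inrLinear N = 0 := by ext; simp
    simp [this]

/-- The homomorphism `B → S ⊕ N` inducing the deformation `n ∈ N ⊗ M` of zero. -/
noncomputable def hom (n : N ⊗[R] M) : B →ₐ[R] TrivSqZeroExt S N :=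
  (hu.existsUnique_hom N n).choose

theorem rTensor_hom (n : N ⊗[R] M) :
    (hu.hom N n).toLinearMap.rTensor M u = (inrLinear N).rTensor M n :=
  (hu.existsUnique_hom N n).choose_spec.1

theorem hom_eq {n : N ⊗[R] M} {g : B →ₐ[R] TrivSqZeroExt S N}
    (hg : g.toLinearMap.rTensor M u = (inrLinear N).rTensor M n) : hu.hom N n = g :=
  ((hu.existsUnique_hom N n).choose_spec.2 g hg).symm

/-- For `N = S`, expanding `u` in pure tensors turns this into the dual basis identity. -/
theorem rTensor_snd_hom (n : N ⊗[R] M) :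
    (sndLinear N ∘ₗ (hu.hom N n).toLinearMap).rTensor M u = n := by
  rw [LinearMap.rTensor_comp, LinearMap.comp_apply, hu.rTensor_hom, ← LinearMap.comp_apply,
    ← LinearMap.rTensor_comp]
  have : sndLinear (R := R) (S := S) N ∘ₗ inrLinear N = LinearMap.id := by ext; simp
  simp [this]

variable {N} {N' : Type u} [AddCommGroup N'] [Module S N'] [Module Sᵐᵒᵖ N']
  [IsCentralScalar S N'] [Module R N'] [IsScalarTower R S N']

/-- By uniqueness, `hom` is natural in `N`. This is the only source of linearity for `derivative`.
-/
theorem snd_hom_map (f : N →ₗ[S] N') (n : N ⊗[R] M) (b : B) :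
    (hu.hom N' ((f.restrictScalars R).rTensor M n) b).snd = f (hu.hom N n b).snd := by
  rw [hu.hom_eq (g := ((TrivSqZeroExt.map f).restrictScalars R).comp (hu.hom N n))]
  · simp
  · have h : ((TrivSqZeroExt.map f).restrictScalars R).toLinearMap ∘ₗ inrLinear N =
        inrLinear N' ∘ₗ f.restrictScalars R := by ext <;> simp
    rw [AlgHom.comp_toLinearMap, LinearMap.rTensor_comp, LinearMap.comp_apply, hu.rTensor_hom,
      ← LinearMap.comp_apply, ← LinearMap.rTensor_comp, h, LinearMap.rTensor_comp,
      LinearMap.comp_apply]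

end

/-- An element `b : B` defines an `S`-linear functional on `S ⊗ M`, the derivative of `b` along
the deformations of zero. -/
noncomputable def derivative (b : B) : S ⊗[R] M →ₗ[S] S where
  toFun m := (hu.hom S m b).snd
  map_add' m m' := by
    -- Both deformations are placed in one over `S × S`; its images under `fst`, `snd` and `fst +
    -- snd` are `m`, `m'` and `m + m'`.
    let i₁ := ((LinearMap.inl S S S).restrictScalars R).rTensor M
    let i₂ := ((LinearMap.inr S S S).restrictScalars R).rTensor M
    have h (f : S × S →ₗ[S] S) : f (hu.hom (S × S) (i₁ m + i₂ m') b).snd =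
        (hu.hom S (((f ∘ₗ LinearMap.inl S S S).restrictScalars R).rTensor M m +
          ((f ∘ₗ LinearMap.inr S S S).restrictScalars R).rTensor M m') b).snd := by
      rw [← hu.snd_hom_map, map_add, ← LinearMap.comp_apply, ← LinearMap.comp_apply,
        ← LinearMap.rTensor_comp, ← LinearMap.rTensor_comp]
      rfl
    have h₁ := h (LinearMap.fst S S S)
    have h₂ := h (LinearMap.snd S S S)
    have h₃ := h (LinearMap.fst S S S + LinearMap.snd S S S)
    rw [LinearMap.add_apply, h₁, h₂] at h₃
    simpa [LinearMap.add_comp] using h₃.symm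
  map_smul' s m := by
    have h : ((LinearMap.lsmul S S s).restrictScalars R).rTensor M m = s • m := by
      induction m with
      | zero => simp
      | add x y hx hy => rw [map_add, hx, hy, smul_add]
      | tmul a x => simp [TensorProduct.smul_tmul']
    have := hu.snd_hom_map (LinearMap.lsmul S S s) m b
    rwa [h] at this

include hu in
theorem finite_and_projective :
    Module.Finite S (S ⊗[R] M) ∧ Module.Projective S (S ⊗[R] M) := by
  obtain ⟨t, ht⟩ := TensorProduct.exists_finset u
  refine Module.finite_and_projective_of_dual_basis (ι := t) (fun i ↦ hu.derivative i.1.1)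
    -- The index set is the finite set of pairs `(b, x)` in an expression of `u` as a sum of pure
    -- tensors.
    (fun i ↦ 1 ⊗ₜ i.1.2) fun m ↦ ?_
  refine Eq.trans ?_ ((congrArg _ ht.symm).trans (hu.rTensor_snd_hom S m))
  rw [finsum_eq_sum_of_fintype, map_sum, ← Finset.sum_attach t]
  refine Finset.sum_congr rfl fun i _ ↦ ?_
  simp only [LinearMap.rTensor_tmul, TensorProduct.smul_tmul', smul_eq_mul, mul_one]
  rfl

end IsInfinitesimallyUniversal
end DualBasis

/-! ### Representability implies finite projective -/

section InfinitesimalNeighborhood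

variable {R : Type u} [CommRing R]

theorem specOverMap_injective {A B : CommAlgCat.{u} R} :
    Function.Injective (specOverMap : (A ⟶ B) → (specOver B ⟶ specOver A)) := by
  intro f g h
  have h' : CommRingCat.ofHom f.hom.toRingHom = CommRingCat.ofHom g.hom.toRingHom :=
    Spec.map_injective congr(($h).left)
  ext x
  exact congr(($h').hom x)

theorem specOverMap_surjective {A B : CommAlgCat.{u} R} :
    Function.Surjective (specOverMap : (A ⟶ B) → (specOver B ⟶ specOver A)) := by
  intro k
  obtain ⟨f, hf⟩ := Spec.map_surjective k.left
  have hw : CommRingCat.ofHom (algebraMap R A) ≫ f = CommRingCat.ofHom (algebraMap R B) := by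
    apply Spec.map_injective
    rw [Spec.map_comp, hf]
    exact Over.w k
  refine ⟨CommAlgCat.ofHom ⟨f.hom, fun r ↦ congr(($hw).hom r)⟩, ?_⟩
  apply Over.OverMorphism.ext
  exact hf

variable {M : Type u} [AddCommGroup M] [Module R M] {X : Over (Spec (.of R))}
  (φ : ∀ A : CommAlgCat.{u} R, A ⊗[R] M ≃ (specOver A ⟶ X))
  (hφ : ∀ {A B : CommAlgCat.{u} R} (f : A ⟶ B) (y : A ⊗[R] M),
    φ B (f.hom.toLinearMap.rTensor M y) = specOverMap f ≫ φ A y)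

include hφ in
/-- An affine open subscheme containing the zero section over `S` is infinitesimally universal. -/
theorem isInfinitesimallyUniversal_of_isOpenImmersion {S B : CommAlgCat.{u} R} (j : specOver B ⟶ X)
    [IsOpenImmersion j.left] (hj : Set.range (φ S 0).left ⊆ Set.range j.left) :
    IsInfinitesimallyUniversal S ((φ B).symm j) := by
  intro A _ _ π hπ hnil y hy
  let π' : CommAlgCat.of R A ⟶ S := CommAlgCat.ofHom π
  have hy' : φ S 0 = specOverMap π' ≫ φ (.of R A) y := by rw [← hφ, ← hy]; rfl
  -- A nil kernel lies in every prime, so `Spec S → Spec A` is surjective and the point `y` has the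
  -- same image as the zero section.
  have hsurj : Function.Surjective (specOverMap π').left := by
    intro x
    have : Function.Surjective (PrimeSpectrum.comap π.toRingHom) := by
      rw [← Set.range_eq_univ, range_comap_of_surjective _ _ hπ, PrimeSpectrum.zeroLocus_eq_univ_iff]
      intro a ha
      exact hnil a ha
    exact this x
  have hrange : Set.range (φ (.of R A) y).left ⊆ Set.range j.left := by
    rw [← Set.image_univ, ← hsurj.range_eq, ← Set.range_comp]
    rw [hy'] at hj
    exact hj
  have key (g : B ⟶ .of R A) : g.hom.toLinearMap.rTensor M ((φ B).symm j) = y ↔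
      specOverMap g ≫ j = φ (.of R A) y := by
    rw [← (φ (.of R A)).injective.eq_iff, hφ, Equiv.apply_symm_apply]
  let l : specOver (.of R A) ⟶ specOver B :=
    Over.homMk (IsOpenImmersion.lift j.left (φ (.of R A) y).left hrange) (by
      rw [← Over.w j, IsOpenImmersion.lift_fac_assoc, Over.w])
  have hl : l ≫ j = φ (.of R A) y := by
    apply Over.OverMorphism.ext
    exact IsOpenImmersion.lift_fac _ _ _
  obtain ⟨g, hg⟩ := specOverMap_surjective l
  refine ⟨g.hom, (key g).2 (hg ▸ hl), fun g' hg' ↦ ?_⟩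
  have h := (key (CommAlgCat.ofHom g')).1 hg'
  have : CommAlgCat.ofHom g' = g := by
    apply specOverMap_injective
    apply Over.OverMorphism.ext
    rw [← cancel_mono j.left]
    exact congrArg Over.Hom.left (h.trans (hg ▸ hl).symm)
  rw [← this]
  rfl

theorem exists_isOpenImmersion_specOver (x : X.left) : ∃ (B : CommAlgCat.{u} R)
    (j : specOver B ⟶ X), IsOpenImmersion j.left ∧ x ∈ Set.range j.left := by
  obtain ⟨V, hV, hx, -⟩ := exists_isAffineOpen_mem_and_subset (U := ⊤) (Set.mem_univ x)
  obtain ⟨ρ, hρ⟩ := Spec.map_surjective (hV.fromSpec ≫ X.hom)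
  let := ρ.hom.toAlgebra
  refine ⟨.of R Γ(X.left, V), Over.homMk hV.fromSpec hρ.symm, ?_, ?_⟩
  · exact inferInstanceAs (IsOpenImmersion hV.fromSpec)
  · change x ∈ Set.range hV.fromSpec
    rwa [hV.range_fromSpec]

-- By naturality the zero section over `S` is the one over `R` composed with `Spec S → Spec R`, so
-- only its topological image has to be checked.
include hφ in
theorem finite_and_projective_tensor_of_range_subset {B : CommAlgCat.{u} R} (j : specOver B ⟶ X)
    [IsOpenImmersion j.left] (S : Type u) [CommRing S] [Algebra R S]
    (hS : ∀ q : PrimeSpectrum S,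
      (φ (.of R R) 0).left (q.comap (algebraMap R S)) ∈ Set.range j.left) :
    Module.Finite S (S ⊗[R] M) ∧ Module.Projective S (S ⊗[R] M) := by
  refine (isInfinitesimallyUniversal_of_isOpenImmersion φ hφ (S := .of R S) j
    ?_).finite_and_projective
  have h := hφ (A := .of R R) (B := .of R S) (CommAlgCat.ofHom (Algebra.ofId R S)) 0
  rw [map_zero] at h
  rw [h]
  rintro _ ⟨q, rfl⟩
  exact hS q

-- Affine opens around the points of the zero section pull back to neighbourhoods covering `Spec R`,
-- each containing some basic open `D(f)`.
include hφ in
theorem finite_and_projective_of_representable : Module.Finite R M ∧ Module.Projective R M := by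
  let e : Spec (.of R) ⟶ X.left := (φ (.of R R) 0).left
  have key (p : PrimeSpectrum R) : ∃ (B : CommAlgCat.{u} R) (j : specOver B ⟶ X) (f : R),
      IsOpenImmersion j.left ∧ f ∉ p.asIdeal ∧
        ∀ q : PrimeSpectrum R, f ∉ q.asIdeal → e q ∈ Set.range j.left := by
    obtain ⟨B, j, hj, hx⟩ := exists_isOpenImmersion_specOver (e p)
    obtain ⟨_, ⟨_, ⟨f, rfl⟩, rfl⟩, hpf, hf⟩ :=
      PrimeSpectrum.isBasis_basic_opens.exists_subset_of_mem_open (a := p)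
        (show p ∈ e ⁻¹' Set.range j.left from hx)
        (j.left.isOpenEmbedding.isOpen_range.preimage e.continuous)
    exact ⟨B, j, f, hj, hpf, fun q hq ↦ hf hq⟩
  choose B j f hj hf hq using key
  have hspan : Ideal.span (Set.range f) = ⊤ := by
    by_contra h
    obtain ⟨m, hm, hle⟩ := Ideal.exists_le_maximal _ h
    exact hf ⟨m, hm.isPrime⟩ (hle (Ideal.subset_span ⟨_, rfl⟩))
  -- Projectivity can be tested at maximal ideals once `M` is finitely presented, which is glued
  -- from the cover by the `D(f)`.
  have : Module.FinitePresentation R M := by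
    refine Module.FinitePresentation.of_localizationSpan' (Set.range f) hspan
      (Rₚ := fun g ↦ Localization.Away g.1)
      (fun g ↦ TensorProduct.mk R (Localization.Away g.1) M 1) ?_
    rintro ⟨_, p, rfl⟩
    have := hj p
    obtain ⟨_, _⟩ := finite_and_projective_tensor_of_range_subset φ hφ (j p)
      (Localization.Away (f p)) fun q ↦ hq p _ fun hmem ↦ q.2.ne_top
        (Ideal.eq_top_of_isUnit_mem _ hmem (IsLocalization.Away.algebraMap_isUnit (f p)))
    exact Module.finitePresentation_of_projective _ _
  refine ⟨inferInstance, Module.projective_of_localization_maximal'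
    (fun P ↦ Localization.AtPrime P) (fun P _ ↦ Localization.AtPrime P ⊗[R] M)
    (fun P _ ↦ TensorProduct.mk R (Localization.AtPrime P) M 1) fun P hP ↦ ?_⟩
  let p : PrimeSpectrum R := ⟨P, hP.isPrime⟩
  have := hj p
  exact (finite_and_projective_tensor_of_range_subset φ hφ (j p)
    (Localization.AtPrime P) fun q ↦ hq p _ fun hmem ↦ q.2.ne_top
      (Ideal.eq_top_of_isUnit_mem _ hmem
        (IsLocalization.map_units _ (⟨f p, hf p⟩ : P.primeCompl)))).2

end InfinitesimalNeighborhood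

theorem finite_and_projective_of_isQcqsModuleScheme {R : Type u} [CommRing R] {M : Type u}
    [AddCommGroup M] [Module R M] (h : (quasiCoherentFunctor R M).IsQcqsModuleScheme) :
    Module.Finite R M ∧ Module.Projective R M := by
  obtain ⟨X, -, -, ⟨i⟩⟩ := h
  exact finite_and_projective_of_representable (fun A ↦ (i.app A).toEquiv) i.naturality

/-! ### The module scheme `Spec (Sym P)` -/

section LinearScheme

variable {R : Type u} [CommRing R]

/-- The structure homomorphism from `R` to the ring of global functions of an `R`-scheme. -/
noncomputable def structureRingHom (T : Over (Spec (.of R))) : R →+* Γ(T.left, ⊤) :=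
  ((Scheme.ΓSpecIso (.of R)).inv ≫ T.hom.appTop).hom

theorem appTop_structureRingHom {S T : Over (Spec (.of R))} (f : S ⟶ T) (r : R) :
    f.left.appTop (structureRingHom T r) = structureRingHom S r := by
  have h : T.hom.appTop ≫ f.left.appTop = S.hom.appTop := by
    rw [← Scheme.Hom.comp_appTop, Over.w]
  exact congr($h _)

theorem structureRingHom_specOver (A : CommAlgCat.{u} R) (r : R) :
    structureRingHom (specOver A) r = (Scheme.ΓSpecIso (.of A)).inv (algebraMap R A r) :=
  congr($(Scheme.ΓSpecIso_inv_naturality (CommRingCat.ofHom (algebraMap R A))) r).symm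

variable (P : Type u) [AddCommGroup P] [Module R P]

/-- The linear maps from the `R`-module `P` to the global functions on an `R`-scheme `T`. -/
abbrev LinearPoints (T : Over (Spec (.of R))) : Type u := P →ₛₗ[structureRingHom T] Γ(T.left, ⊤)

variable {P}

/-- Pullback of linear points along a morphism of `R`-schemes. -/
noncomputable def LinearPoints.pullback {S T : Over (Spec (.of R))} (f : S ⟶ T) :
    LinearPoints P T →+ LinearPoints P S where
  toFun l :=
    { toFun p := f.left.appTop (l p)
      map_add' p q := by simp
      map_smul' r p := by simp [appTop_structureRingHom] }
  map_zero' := by ext; simp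
  map_add' l l' := by ext; simp

@[simp]
theorem LinearPoints.pullback_apply {S T : Over (Spec (.of R))} (f : S ⟶ T) (l : LinearPoints P T)
    (p : P) : LinearPoints.pullback f l p = f.left.appTop (l p) := rfl

theorem LinearPoints.pullback_smul {S T : Over (Spec (.of R))} (f : S ⟶ T) (a : Γ(T.left, ⊤))
    (l : LinearPoints P T) : pullback f (a • l) = f.left.appTop a • pullback f l := by
  ext; simp

variable (P)

/-- The spectrum of the symmetric algebra of `P`. -/
noncomputable abbrev linearScheme : Over (Spec (.of R)) :=
  specOver (.of R (SymmetricAlgebra R P))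

variable {P}

/-- The linear point given by the restriction to `P` of the comorphism of `T ⟶ Spec (Sym P)`. -/
noncomputable def linearPoint {T : Over (Spec (.of R))} (x : T ⟶ linearScheme P) :
    LinearPoints P T where
  toFun p := x.left.appTop
    ((Scheme.ΓSpecIso (.of (SymmetricAlgebra R P))).inv (SymmetricAlgebra.ι R P p))
  map_add' p q := by simp
  map_smul' r p := by
    rw [map_smul, Algebra.smul_def, map_mul, map_mul, smul_eq_mul, ← appTop_structureRingHom x]
    congr 2
    exact (structureRingHom_specOver (.of R (SymmetricAlgebra R P)) r).symm

theorem linearPoint_comp {S T : Over (Spec (.of R))} (f : S ⟶ T) (x : T ⟶ linearScheme P) :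
    linearPoint (f ≫ x) = LinearPoints.pullback f (linearPoint x) := by
  ext p
  change (f.left ≫ x.left).appTop _ = _
  rw [Scheme.Hom.comp_appTop]
  rfl

/-- A morphism to an affine scheme is determined on global functions, and an algebra map out of `Sym
P` by its restriction to `P`. -/
theorem linearPoint_injective (T : Over (Spec (.of R))) :
    Function.Injective (linearPoint : (T ⟶ linearScheme P) → _) := by
  intro x y h
  apply Over.OverMorphism.ext
  apply ext_to_Spec
  let := (structureRingHom T).toAlgebra
  let c (z : T ⟶ linearScheme P) : SymmetricAlgebra R P →ₐ[R] Γ(T.left, ⊤) :=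
    ⟨((Scheme.ΓSpecIso (.of (SymmetricAlgebra R P))).inv ≫ z.left.appTop).hom, fun r ↦ by
      refine Eq.trans ?_ (appTop_structureRingHom z r)
      exact congr(z.left.appTop $((structureRingHom_specOver
        (.of R (SymmetricAlgebra R P)) r).symm))⟩
  have hc : c x = c y := SymmetricAlgebra.algHom_ext (by
    ext p
    exact congr($h p))
  ext s
  exact congr($hc s)

theorem linearPoint_surjective (T : Over (Spec (.of R))) :
    Function.Surjective (linearPoint : (T ⟶ linearScheme P) → _) := by
  intro l
  let := (structureRingHom T).toAlgebra
  let l' : P →ₗ[R] Γ(T.left, ⊤) := ⟨l.toAddHom, l.map_smulₛₗ⟩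
  let g := CommRingCat.ofHom (SymmetricAlgebra.lift l').toRingHom
  let x := ΓSpec.adjunction.homEquiv T.left (op (.of (SymmetricAlgebra R P))) g.op
  have hx : (Scheme.ΓSpecIso (.of (SymmetricAlgebra R P))).inv ≫ x.appTop = g :=
    ΓSpecIso_inv_ΓSpec_adjunction_homEquiv g
  refine ⟨Over.homMk x ?_, ?_⟩
  · apply ext_to_Spec
    ext r
    change (x ≫ (linearScheme P).hom).appTop _ = structureRingHom T r
    rw [Scheme.Hom.comp_appTop]
    change x.appTop (structureRingHom (linearScheme P) r) = _
    rw [structureRingHom_specOver]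
    exact congr($hx _).trans ((SymmetricAlgebra.lift l').commutes r)
  · ext p
    exact congr($hx _).trans (SymmetricAlgebra.lift_ι_apply l' p)

variable (P) in
/-- The `T`-points of `Spec (Sym P)` are the linear maps from `P` to the functions on `T`. -/
noncomputable def linearPointEquiv (T : Over (Spec (.of R))) :
    (T ⟶ linearScheme P) ≃ LinearPoints P T :=
  .ofBijective linearPoint ⟨linearPoint_injective T, linearPoint_surjective T⟩

theorem linearPointEquiv_comp {S T : Over (Spec (.of R))} (f : S ⟶ T) (x : T ⟶ linearScheme P) :
    linearPointEquiv P S (f ≫ x) = LinearPoints.pullback f (linearPointEquiv P T x) :=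
  linearPoint_comp f x

variable (P)

/-- The presheaf of linear points. -/
noncomputable def linearPointsFunctor : (Over (Spec (.of R)))ᵒᵖ ⥤ AddGrpCat.{u} where
  obj T := .of (LinearPoints P T.unop)
  map f := AddGrpCat.ofHom (LinearPoints.pullback f.unop)
  map_id T := by
    ext l p
    change (𝟙 T.unop : T.unop ⟶ T.unop).left.appTop (l p) = l p
    simp
  map_comp f g := by
    ext l p
    exact congr($(Scheme.Hom.comp_appTop g.unop.left f.unop.left) (l p))

/-- `Spec (Sym P)` represents the presheaf of linear points. -/
noncomputable def linearPointsRepresentableBy :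
    (linearPointsFunctor P ⋙ forget _).RepresentableBy (linearScheme (R := R) P) where
  homEquiv {T} := linearPointEquiv P T
  homEquiv_comp f x := linearPointEquiv_comp f x

noncomputable instance : AddGrpObj (linearScheme (R := R) P) :=
  .ofRepresentableBy _ (linearPointsFunctor P) (linearPointsRepresentableBy P)

/-- The group law was defined through representability, so additivity is built in; with
`linearPointEquiv_act` it reduces the module axioms to those of linear maps. -/
theorem linearPointEquiv_add {T : Over (Spec (.of R))} (x y : T ⟶ linearScheme P) :
    linearPointEquiv P T (x + y) = linearPointEquiv P T x + linearPointEquiv P T y :=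
  ((yonedaAddGrpObjIsoOfRepresentableBy _ (linearPointsFunctor P)
    (linearPointsRepresentableBy P)).hom.app (op T)).hom.map_add x y

instance : IsCommAddMonObj (linearScheme (R := R) P) where
  add_comm := by
    -- Commutativity is checked on points, then applied to the universal pair of projections.
    have h (T : Over (Spec (.of R))) (x y : T ⟶ linearScheme P) : x + y = y + x := by
      apply (linearPointEquiv P T).injective
      rw [linearPointEquiv_add, linearPointEquiv_add, add_comm]
    have hβ : (β_ (linearScheme (R := R) P) (linearScheme P)).hom = lift (snd _ _) (fst _ _) := by
      ext <;> simp
    refine Eq.trans ?_ ((h _ (snd _ _) (fst _ _)).trans ?_)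
    · rw [hβ]
      rfl
    · change lift (fst _ _) (snd _ _) ≫ _ = _
      rw [lift_fst_snd, Category.id_comp]

/-- The action of the affine line on `Spec (Sym P)`. -/
noncomputable def linearAct : affineLine R ⊗ linearScheme P ⟶ linearScheme P :=
  (linearPointEquiv P _).symm ((affineLineEquiv _).symm (fst (affineLine R) (linearScheme P)) •
    linearPointEquiv P _ (snd _ _))

/-- `linearAct` is scalar multiplication on the universal point of the product; pulling back along
`(a, x)` gives it on all points. -/
theorem linearPointEquiv_act {T : Over (Spec (.of R))} (a : Γ(T.left, ⊤)) (x : T ⟶ linearScheme P) :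
    linearPointEquiv P T (lift (affineLinePoint a) x ≫ linearAct P) =
      a • linearPointEquiv P T x := by
  have h : (lift (affineLinePoint a) x).left.appTop ((affineLineEquiv (affineLine R ⊗ linearScheme P)).symm
      (fst (affineLine R) (linearScheme P))) = a := by
    apply (affineLineEquiv T).injective
    change affineLinePoint _ = affineLinePoint _
    rw [← comp_affineLinePoint]
    change _ ≫ affineLineEquiv _ _ = _
    rw [Equiv.apply_symm_apply, lift_fst]
  rw [linearPointEquiv_comp, linearAct, Equiv.apply_symm_apply, LinearPoints.pullback_smul, h,
    ← linearPointEquiv_comp, lift_snd]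

/-- The module scheme `Spec (Sym P)`. -/
noncomputable def linearModuleScheme : ModuleScheme R where
  X := linearScheme P
  act := linearAct P
  act_add a x y := (linearPointEquiv P _).injective (by
    simp only [linearPointEquiv_add, linearPointEquiv_act, smul_add])
  add_act a b x := (linearPointEquiv P _).injective (by
    simp only [linearPointEquiv_add, linearPointEquiv_act, add_smul])
  mul_act a b x := (linearPointEquiv P _).injective (by
    simp only [linearPointEquiv_act, mul_smul])
  one_act x := (linearPointEquiv P _).injective (by
    simp only [linearPointEquiv_act, one_smul])

/-- The linear points over `Spec A` are the linear maps `P → A`. -/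
noncomputable def linearPointsSpecEquiv (A : CommAlgCat.{u} R) :
    LinearPoints P (specOver A) ≃ (P →ₗ[R] A) where
  toFun l :=
    { toFun p := (Scheme.ΓSpecIso (.of A)).hom (l p)
      map_add' p q := by simp
      map_smul' r p := by
        rw [map_smulₛₗ, structureRingHom_specOver, smul_eq_mul, map_mul, Algebra.smul_def]
        congr 1
        exact congr($((Scheme.ΓSpecIso (.of A)).inv_hom_id) _) }
  invFun l :=
    { toFun p := (Scheme.ΓSpecIso (.of A)).inv (l p)
      map_add' p q := by simp
      map_smul' r p := by
        rw [map_smul, structureRingHom_specOver, smul_eq_mul, ← map_mul, Algebra.smul_def] }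
  left_inv l := by
    ext p
    exact congr($((Scheme.ΓSpecIso (.of A)).hom_inv_id) (l p))
  right_inv l := by
    ext p
    exact congr($((Scheme.ΓSpecIso (.of A)).inv_hom_id) (l p))

/-- The `A`-points of `Spec (Sym P)` are the linear maps `P → A`. -/
noncomputable def linearSchemePointsEquiv (A : CommAlgCat.{u} R) :
    (specOver A ⟶ linearScheme P) ≃ (P →ₗ[R] A) :=
  (linearPointEquiv P (specOver A)).trans (linearPointsSpecEquiv P A)

theorem linearSchemePointsEquiv_apply {A : CommAlgCat.{u} R} (x : specOver A ⟶ linearScheme P)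
    (p : P) : linearSchemePointsEquiv P A x p =
      (Scheme.ΓSpecIso (.of A)).hom (linearPointEquiv P (specOver A) x p) := rfl

theorem linearSchemePointsEquiv_add {A : CommAlgCat.{u} R} (x y : specOver A ⟶ linearScheme P) :
    linearSchemePointsEquiv P A (x + y) =
      linearSchemePointsEquiv P A x + linearSchemePointsEquiv P A y := by
  ext p
  simp [linearSchemePointsEquiv_apply, linearPointEquiv_add]

theorem linearSchemePointsEquiv_act {A : CommAlgCat.{u} R} (a : A)
    (x : specOver A ⟶ linearScheme P) :
    linearSchemePointsEquiv P A (lift (affineLinePoint (T := specOver A)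
      ((Scheme.ΓSpecIso (.of A)).inv a)) x ≫ linearAct P) = a • linearSchemePointsEquiv P A x := by
  ext p
  rw [linearSchemePointsEquiv_apply, linearPointEquiv_act, LinearMap.smul_apply, smul_eq_mul,
    map_mul]
  exact congr($(congr($((Scheme.ΓSpecIso (.of A)).inv_hom_id) a)) * _)

theorem linearSchemePointsEquiv_specOverMap_comp {A B : CommAlgCat.{u} R} (f : A ⟶ B)
    (x : specOver A ⟶ linearScheme P) : linearSchemePointsEquiv P B (specOverMap f ≫ x) =
      f.hom.toLinearMap ∘ₗ linearSchemePointsEquiv P A x := by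
  ext p
  rw [linearSchemePointsEquiv_apply, linearPointEquiv_comp, LinearPoints.pullback_apply]
  exact congr($(Scheme.ΓSpecIso_naturality (CommRingCat.ofHom f.hom.toRingHom)) _)

/-- The functor of points of `Spec (Sym P)` is `A ↦ Hom(P, A)`, as an `𝓡`-module. -/
noncomputable def linearModuleSchemePointsEquiv (A : CommAlgCat.{u} R) :
    (linearModuleScheme P).functorOfPoints.obj A ≃ₗ[A] (P →ₗ[R] A) where
  __ := linearSchemePointsEquiv P A
  map_add' := linearSchemePointsEquiv_add P
  map_smul' := linearSchemePointsEquiv_act P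

end LinearScheme

/-! ### Finite projective implies representability -/

section FiniteProjective

variable {R : Type u} [CommRing R] (M : Type u) [AddCommGroup M] [Module R M] [Module.Finite R M]
  [Module.Projective R M]

/-- For `M` finite projective, `A ⊗ M` is the module of linear maps `M* → A`. -/
noncomputable def tensorEquivDualHom (A : Type u) [CommRing A] [Algebra R A] :
    A ⊗[R] M ≃ₗ[A] (Module.Dual R M →ₗ[R] A) :=
  let e := TensorProduct.comm R A M ≪≫ₗ (Module.evalEquiv R M).rTensor A ≪≫ₗ
    dualTensorHomEquiv R (Module.Dual R M) A
  { e with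
    map_smul' a x := by
      change e (a • x) = a • e x
      induction x with
      | zero => simp
      | add x y hx hy => rw [smul_add, map_add, map_add, hx, hy, smul_add]
      | tmul b m =>
        ext l
        simp [e, TensorProduct.smul_tmul'] }

theorem tensorEquivDualHom_tmul {A : Type u} [CommRing A] [Algebra R A] (a : A) (m : M)
    (l : Module.Dual R M) : tensorEquivDualHom M A (a ⊗ₜ m) l = l m • a := by
  simp [tensorEquivDualHom]

theorem tensorEquivDualHom_rTensor {A B : Type u} [CommRing A] [Algebra R A] [CommRing B]
    [Algebra R B] (f : A →ₐ[R] B) (x : A ⊗[R] M) :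
    tensorEquivDualHom M B (f.toLinearMap.rTensor M x) =
      f.toLinearMap ∘ₗ tensorEquivDualHom M A x := by
  induction x with
  | zero => simp
  | add x y hx hy => simp only [map_add, hx, hy, LinearMap.comp_add]
  | tmul a m =>
    ext l
    simp [tensorEquivDualHom_tmul]

theorem isQcqsModuleScheme_of_finite_of_projective :
    (quasiCoherentFunctor R M).IsQcqsModuleScheme := by
  let X := linearModuleScheme (R := R) (Module.Dual R M)
  refine ⟨X, inferInstanceAs (CompactSpace (Spec _)), inferInstanceAs (QuasiSeparatedSpace (Spec _)),
    ⟨⟨fun A ↦ (tensorEquivDualHom M A).trans (linearModuleSchemePointsEquiv _ A).symm, ?_⟩⟩⟩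
  intro A B f x
  -- Naturality is compared inside `Hom(M*, B)`, where both sides are postcomposition with `f`.
  refine (linearModuleSchemePointsEquiv (Module.Dual R M) B).injective ?_
  refine ((linearModuleSchemePointsEquiv (Module.Dual R M) B).apply_symm_apply _).trans ?_
  refine (tensorEquivDualHom_rTensor M f.hom x).trans ?_
  refine Eq.trans ?_ (linearSchemePointsEquiv_specOverMap_comp (Module.Dual R M) f _).symm
  exact congr(f.hom.toLinearMap ∘ₗ
    $(((linearModuleSchemePointsEquiv (Module.Dual R M) A).apply_symm_apply _).symm))

end FiniteProjective

theorem mainTheorem10 (R : Type u) [CommRing R] (M : Type u) [AddCommGroup M] [Module R M] :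
    (quasiCoherentFunctor R M).IsQcqsModuleScheme ↔
      Module.Finite R M ∧ Module.Projective R M :=
  ⟨finite_and_projective_of_isQcqsModuleScheme,
    fun ⟨_, _⟩ ↦ isQcqsModuleScheme_of_finite_of_projective M⟩
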